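/- **Regularity lemma for finite stable graphs (no explicit bounds, no equitability).** A bipartite graph $(V,W,R)$ has the $k$-order property if there are $a_0,\dots,a_k\in V$ and $b_0,\dots,b_k\in W$ such that $R(a_i,b_j)$ holds if and only if $i\le j$; a graph $(V,E)$ has it if the bipartite graph $(V,V,E)$ has. For finite sets $A\subseteq V$, $B\subseteq W$, a relation $S\subseteq V\times W$ and $\epsilon>0$, say that *$S$ holds $\epsilon$-almost everywhere on $(A,B)$* if, for all $a\in A$ outside a set of at most $\epsilon|A|$ elements, for all $b\in B$ outside a set of at most $\epsilon|B|$ elements, $S(a,b)$ holds, and dually, for all $b\in B$ outside a set of at most $\epsilon|B|$ elements, for all $a\in A$ outside a set of at most $\epsilon|A|$ elements, $S(a,b)$ holds. Write $d(A,B)=|R\cap(A\times B)|/(|A||B|)$ for nonempty $A,B$. For every $k\ge 0$ and every real $\epsilon>0$ there is $N$ such that, for every finite bipartite graph $(V,W,R)$ without the $k$-order property, $V$ can be partitioned into at most $N$ nonempty sets $V_i$, each defined by a Boolean combination of at most $N$ (occurrences of) formulas of the form $R(x,b)$ $(b\in W)$ and $x=a$ $(a\in V)$, and $W$ can be partitioned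 into at most $N$ nonempty sets $W_j$, each defined by a Boolean combination of at most $N$ formulas of the form $R(a,y)$ $(a\in V)$ and $y=b$ $(b\in W)$, such that for **every** pair $(V_i,W_j)$: 1. at least one of the following holds: (i) $R$ holds $\epsilon$-almost everywhere on $(V_i,W_j)$, and also on $(A,B)$ for arbitrary subsets $A\subseteq V_i$, $B\subseteq W_j$ with $|A|\ge\epsilon|V_i|$, $|B|\ge\epsilon|W_j|$; and $d(V_i,W_j)>1-\epsilon$; (ii) the same with $\neg R$ in place of $R$, and $d(V_i,W_j)<\epsilon$; 2. if $\epsilon<\tfrac12$, then $R$ and $\neg R$ do not both hold $\epsilon$-almost everywhere on $(V_i,W_j)$ (so that exactly one of (i), (ii) holds); 3. the pair is $\epsilon$-regular: $|d(A,B)-d(V_i,W_j)|<\epsilon$ for all $A\subseteq V_i$, $B\subseteq W_j$ with $|A|\ge\epsilon|V_i|$ and $|B|\ge\epsilon|W_j|$. Moreover, with the same $N$, for every finite simple graph $(V,E)$ without the $k$-order property there is a single partition of $V$ into at most $N$ nonempty sets, each defined by a Boolean combination of at most $N$ formulas of the form $E(x,b)$ and $x=a$, such that 1–3 hold, with $R=E$,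 for every pair of parts (including a part paired with itself). -/

import Mathlib

universe u v

namespace StableGraph

/-- The bipartite graph `(V, W, R)` has the `k`-order property: there are `a i ∈ V`, `b i ∈ W` for
`0 ≤ i ≤ k` such that `R (a i) (b j)` holds iff `i ≤ j`. -/
def HasOrderProperty {V W : Type*} (R : V → W → Prop) (k : ℕ) : Prop :=
  ∃ (a : Fin (k + 1) → V) (b : Fin (k + 1) → W), ∀ i j, R (a i) (b j) ↔ i ≤ j

/-- Formulas in one variable `x` ranging over `V`: finite Boolean combinations of the atomic
formulas `R(x, b)` with `b ∈ W` and `x = a` with `a ∈ V`. -/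
inductive DeltaFormula (V W : Type*) where
  | falsum : DeltaFormula V W
  | edge (b : W) : DeltaFormula V W
  | eq (a : V) : DeltaFormula V W
  | neg (φ : DeltaFormula V W) : DeltaFormula V W
  | and (φ ψ : DeltaFormula V W) : DeltaFormula V W

/-- Truth of a formula at `x`, where `R` interprets the edge relation. -/
def DeltaFormula.Realize {V W : Type*} (R : V → W → Prop) : DeltaFormula V W → V → Prop
  | .falsum, _ => False
  | .edge b, x => R x b
  | .eq a, x => x = a
  | .neg φ, x => ¬ φ.Realize R x
  | .and φ ψ, x => φ.Realize R x ∧ ψ.Realize R x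

/-- The number of occurrences of atomic formulas `R(x, b)`, `x = a`. -/
def DeltaFormula.numAtoms {V W : Type*} : DeltaFormula V W → ℕ
  | .falsum => 0
  | .edge _ => 1
  | .eq _ => 1
  | .neg φ => φ.numAtoms
  | .and φ ψ => φ.numAtoms + ψ.numAtoms

/-- `A ⊆ V` is defined by a Boolean combination of at most `N` atomic formulas `R(x, b)`, `x = a`.
(For subsets of `W` use `flip R`, whose atomic formulas are `R(a, y)` and `y = b`.) -/
def DeltaDefinable {V W : Type*} (R : V → W → Prop) (N : ℕ) (A : Finset V) : Prop :=
  ∃ φ : DeltaFormula V W, φ.numAtoms ≤ N ∧ ∀ x, x ∈ A ↔ φ.Realize R x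

/-- For all `a ∈ A` outside a set of size at most `ε |A|`, for all `b ∈ B` outside a set of size at
most `ε |B|`, `S a b` holds. (The normalizing factors of the counting measures cancel.) -/
def MostlyHolds {V W : Type*} (S : V → W → Prop) (ε : ℝ) (A : Finset V) (B : Finset W) : Prop :=
  ∃ E ⊆ A, (E.card : ℝ) ≤ ε * A.card ∧ ∀ a ∈ A, a ∉ E →
    ∃ F ⊆ B, (F.card : ℝ) ≤ ε * B.card ∧ ∀ b ∈ B, b ∉ F → S a b

/-- `MostlyHolds` together with its dual, in which the roles of the two sides are exchanged. -/
def MostlyHoldsBoth {V W : Type*} (S : V → W → Prop) (ε : ℝ) (A : Finset V) (B : Finset W) :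
    Prop :=
  MostlyHolds S ε A B ∧ MostlyHolds (flip S) ε B A

open Classical in
/-- The edge density `|{(a, b) ∈ A × B : R a b}| / (|A| |B|)`. -/
noncomputable def density {V W : Type*} (R : V → W → Prop) (A : Finset V) (B : Finset W) : ℝ :=
  (Rel.edgeDensity R A B : ℝ)

/-- `P A' B'` holds for all `A' ⊆ A`, `B' ⊆ B` with `|A'| ≥ ε |A|` and `|B'| ≥ ε |B|`. -/
def OnLargeSubsets {V W : Type*} (P : Finset V → Finset W → Prop) (ε : ℝ)
    (A : Finset V) (B : Finset W) : Prop :=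
  ∀ A' ⊆ A, ∀ B' ⊆ B, ε * A.card ≤ A'.card → ε * B.card ≤ B'.card → P A' B'

/-- The pair `(A, B)` is nearly complete for `S`, and so are all pairs of its large subsets. -/
def NearlyComplete {V W : Type*} (S : V → W → Prop) (ε : ℝ) (A : Finset V) (B : Finset W) : Prop :=
  MostlyHoldsBoth S ε A B ∧ OnLargeSubsets (MostlyHoldsBoth S ε) ε A B

/-- The usual `ε`-regularity of a pair, in terms of edge densities. -/
def RegularPair {V W : Type*} (R : V → W → Prop) (ε : ℝ) (A : Finset V) (B : Finset W) : Prop :=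
  OnLargeSubsets (fun A' B' => |density R A' B' - density R A B| < ε) ε A B

/-- What the stable regularity lemma asserts of every pair of parts: it is nearly complete and of
density near `1`, or nearly empty and of density near `0`; not both for `ε < 1 / 2`; and it is
`ε`-regular. -/
def StableRegularPair {V W : Type*} (R : V → W → Prop) (ε : ℝ) (A : Finset V) (B : Finset W) :
    Prop :=
  ((NearlyComplete R ε A B ∧ 1 - ε < density R A B) ∨
    (NearlyComplete (fun a b => ¬ R a b) ε A B ∧ density R A B < ε)) ∧
  (ε < 1 / 2 → ¬ (MostlyHoldsBoth R ε A B ∧ MostlyHoldsBoth (fun a b => ¬ R a b) ε A B)) ∧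
  RegularPair R ε A B

end StableGraph

/-!
Call a set `A` of vertices `η`-good if every vertex `b` of the other side is joined to all but a
proportion `η` of `A`, or to at most a proportion `η` of `A`. The theorem follows from two facts.

*Each side has a partition into boundedly many definable good sets.* If `A` is not good then some `b`
splits it into two parts of proportion at least `η`; repeating this produces a complete binary tree,
the height of which is bounded in the absence of the `k`-order property, because a tall tree contains
a half-graph (`exists_not_shatters`, resting on the Ramsey property `Shatters.ramsey` of trees). Hence
every nonempty definable set contains a good one, cut out by boundedly many further edge formulas, of
size at least a fixed proportion `c` of it (`exists_good_subset`). Removing good sets one after the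
other leaves a remainder that shrinks by the factor `1 - c` in each step. After boundedly many steps it
is small compared to the first good set, which has proportion `c` of the whole side, and the union of
the two is still good (`exists_good_finpartition`). Since no equitability is asked for, no part has to
be cut in an undefinable way.

*A pair of good sets has density near `0` or near `1`* (`Good.density_le`). In a good pair, each vertex
of either side is joined to almost all or to almost none of the other side. If many `a ∈ A` were joined
to almost all of `B`, and many `b ∈ B` to almost none of `A`, then the edges between these two sets
would be both many and few. So nearly all vertices of one of the two sides behave alike.

A pair of density very near `0` or `1` has the remaining properties by Markov's inequality, and
they pass to large subsets because these contain a fixed proportion of all pairs.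
-/

namespace StableGraph

open Finset

/-! ### Binary trees and half-graphs -/

/-- `Shatters R d A B`: there is a complete binary tree of height `d`, with inner nodes labelled by
elements of `B`, such that every branch is realized by an element of `A`: at a node labelled `b` one
goes to one child if `R a b` holds and to the other if not. -/
def Shatters {V W : Type*} (R : V → W → Prop) : ℕ → Set V → Set W → Prop
  | 0, A, _ => A.Nonempty
  | d + 1, A, B => ∃ b ∈ B, Shatters R d {a ∈ A | R a b} B ∧ Shatters R d {a ∈ A | ¬ R a b} B

section Shatters

variable {V W : Type*} {R : V → W → Prop}

lemma Shatters.mono {d : ℕ} {A A' : Set V} {B B' : Set W} (h : Shatters R d A B) (hA : A ⊆ A')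
    (hB : B ⊆ B') : Shatters R d A' B' := by
  induction d generalizing A A' with
  | zero => exact Set.Nonempty.mono hA h
  | succ d ih =>
    obtain ⟨b, hb, h1, h2⟩ := h
    exact ⟨b, hB hb, ih h1 fun a ha => ⟨hA ha.1, ha.2⟩, ih h2 fun a ha => ⟨hA ha.1, ha.2⟩⟩

lemma Shatters.nonempty {d : ℕ} {A : Set V} {B : Set W} (h : Shatters R d A B) : A.Nonempty := by
  induction d generalizing A with
  | zero => exact h
  | succ d ih =>
    obtain ⟨b, -, h1, -⟩ := h
    exact (ih h1).mono fun a ha => ha.1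

/-- The Ramsey property of binary trees: if the labels are coloured with two colours, one finds a
monochromatic subtree, with heights adding up. -/
lemma Shatters.ramsey {p q : ℕ} {A : Set V} {B B₁ B₂ : Set W} (hB : B ⊆ B₁ ∪ B₂)
    (h : Shatters R (p + q) A B) : Shatters R p A B₁ ∨ Shatters R q A B₂ := by
  induction hn : p + q generalizing p q A with
  | zero =>
    obtain ⟨rfl, rfl⟩ : p = 0 ∧ q = 0 := by omega
    exact Or.inl h
  | succ n ih =>
    rcases p with _ | p
    · exact Or.inl h.nonempty
    rcases q with _ | q
    · exact Or.inr h.nonempty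
    rw [hn] at h
    obtain ⟨b, hb, h1, h2⟩ := h
    rcases hB hb with hb | hb
    · have e : n = p + (q + 1) := by omega
      rcases ih (p := p) (q := q + 1) (e ▸ h1) e.symm with h1 | h1
      · rcases ih (p := p) (q := q + 1) (e ▸ h2) e.symm with h2 | h2
        · exact Or.inl ⟨b, hb, h1, h2⟩
        · exact Or.inr (h2.mono (fun a ha => ha.1) subset_rfl)
      · exact Or.inr (h1.mono (fun a ha => ha.1) subset_rfl)
    · have e : n = (p + 1) + q := by omega
      rcases ih (p := p + 1) (q := q) (e ▸ h1) e.symm with h1 | h1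
      · exact Or.inl (h1.mono (fun a ha => ha.1) subset_rfl)
      · rcases ih (p := p + 1) (q := q) (e ▸ h2) e.symm with h2 | h2
        · exact Or.inl (h2.mono (fun a ha => ha.1) subset_rfl)
        · exact Or.inr ⟨b, hb, h1, h2⟩

end Shatters

/-- `R` contains a half-graph on `n + n` vertices with sides in `A` and `B`. -/
def HalfGraph {V W : Type*} (R : V → W → Prop) (n : ℕ) (A : Set V) (B : Set W) : Prop :=
  ∃ (a : Fin n → V) (b : Fin n → W),
    (∀ i, a i ∈ A) ∧ (∀ i, b i ∈ B) ∧ ∀ i j, R (a i) (b j) ↔ i ≤ j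

section HalfGraph

variable {V W : Type*} {R : V → W → Prop}

lemma HalfGraph.mono {n : ℕ} {A A' : Set V} {B B' : Set W} (h : HalfGraph R n A B) (hA : A ⊆ A')
    (hB : B ⊆ B') : HalfGraph R n A' B' := by
  obtain ⟨a, b, ha, hb, hab⟩ := h
  exact ⟨a, b, fun i => hA (ha i), fun i => hB (hb i), hab⟩

lemma HalfGraph.cons {n : ℕ} {A : Set V} {B : Set W} {x : V} {y : W} (hx : x ∈ A) (hy : y ∈ B)
    (hxy : R x y) (h : HalfGraph R n {a ∈ A | ¬ R a y} {b ∈ B | R x b}) :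
    HalfGraph R (n + 1) A B := by
  obtain ⟨a, b, ha, hb, hab⟩ := h
  refine ⟨Fin.cons x a, Fin.cons y b, Fin.cases hx fun i => (ha i).1,
    Fin.cases hy fun i => (hb i).1, fun i j => ?_⟩
  cases i using Fin.cases with
  | zero =>
    cases j using Fin.cases with
    | zero => simpa using hxy
    | succ j => simpa using (hb j).2
  | succ i =>
    cases j using Fin.cases with
    | zero => simpa using (ha i).2
    | succ j => simpa using hab i j

/-- A half-graph of `¬ R`, read backwards and shifted by one, is a half-graph of `R`. -/
lemma HalfGraph.hasOrderProperty_of_not {k : ℕ} {A : Set V} {B : Set W}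
    (h : HalfGraph (fun a b => ¬ R a b) (k + 2) A B) : HasOrderProperty R k := by
  obtain ⟨a, b, -, -, hab⟩ := h
  refine ⟨fun i => a ⟨k + 1 - i, by omega⟩, fun j => b ⟨k - j, by omega⟩, fun i j => ?_⟩
  have hi := i.2
  have hj := j.2
  refine not_iff_not.1 ((hab ⟨k + 1 - i, by omega⟩ ⟨k - j, by omega⟩).trans ?_)
  simp only [Fin.le_def]
  omega

lemma HalfGraph.hasOrderProperty {k : ℕ} {A : Set V} {B : Set W}
    (h : HalfGraph R (k + 1) A B) : HasOrderProperty R k := by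
  obtain ⟨a, b, -, -, hab⟩ := h
  exact ⟨a, b, hab⟩

end HalfGraph

/-- Large shattered trees contain large half-graphs, of `R` or of its complement. Given a tree, any
`a ∈ A` colours the labels `b` by the truth value of `R a b`; on a monochromatic subtree, `a` and the
root label start a half-graph which is continued in one of the two subtrees below the root. -/
lemma exists_halfGraph_of_shatters (n : ℕ) : ∀ p q : ℕ, p + q = n → ∃ d : ℕ,
    ∀ {V : Type u} {W : Type v} (R : V → W → Prop) (A : Set V) (B : Set W), Shatters R d A B →
      HalfGraph R p A B ∨ HalfGraph (fun a b => ¬ R a b) q A B := by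
  induction n with
  | zero =>
    intro p q h
    obtain ⟨rfl, rfl⟩ : p = 0 ∧ q = 0 := by omega
    exact ⟨0, fun R A B _ => Or.inl ⟨Fin.elim0, Fin.elim0, fun i => i.elim0, fun i => i.elim0,
      fun i => i.elim0⟩⟩
  | succ n ih =>
    intro p q h
    rcases p with _ | p
    · exact ⟨0, fun R A B _ => Or.inl ⟨Fin.elim0, Fin.elim0, fun i => i.elim0, fun i => i.elim0,
        fun i => i.elim0⟩⟩
    rcases q with _ | q
    · exact ⟨0, fun R A B _ => Or.inr ⟨Fin.elim0, Fin.elim0, fun i => i.elim0, fun i => i.elim0,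
        fun i => i.elim0⟩⟩
    obtain ⟨d₁, h₁⟩ := ih p (q + 1) (by omega)
    obtain ⟨d₂, h₂⟩ := ih (p + 1) q (by omega)
    refine ⟨(d₁ + 1) + (d₂ + 1), fun {V W} R A B hs => ?_⟩
    obtain ⟨x, hx⟩ := hs.nonempty
    have hB : B ⊆ {b ∈ B | R x b} ∪ {b ∈ B | ¬ R x b} := fun b hb => by
      by_cases hxb : R x b
      · exact Or.inl ⟨hb, hxb⟩
      · exact Or.inr ⟨hb, hxb⟩
    rcases hs.ramsey hB with ⟨y, hy, -, ht⟩ | ⟨y, hy, ht, -⟩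
    · rcases h₁ R _ _ ht with h | h
      · exact Or.inl (.cons hx hy.1 hy.2 h)
      · exact Or.inr (h.mono (fun a ha => ha.1) fun b hb => hb.1)
    · rcases h₂ R _ _ ht with h | h
      · exact Or.inl (h.mono (fun a ha => ha.1) fun b hb => hb.1)
      · exact Or.inr (.cons hx hy.1 hy.2
          (h.mono (fun a ha => ⟨ha.1, not_not.2 ha.2⟩) subset_rfl))

lemma exists_not_shatters (k : ℕ) : ∃ d : ℕ, ∀ {V : Type u} {W : Type v} (R : V → W → Prop),
    ¬ HasOrderProperty R k → ∀ (A : Set V) (B : Set W), ¬ Shatters R d A B := by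
  obtain ⟨d, hd⟩ := exists_halfGraph_of_shatters.{u, v} _ (k + 1) (k + 2) rfl
  exact ⟨d, fun R hR A B hs => hR <| (hd R A B hs).elim HalfGraph.hasOrderProperty
    HalfGraph.hasOrderProperty_of_not⟩

lemma HasOrderProperty.flip {V W : Type*} {R : V → W → Prop} {k : ℕ}
    (h : HasOrderProperty R k) : HasOrderProperty (flip R) k := by
  obtain ⟨a, b, hab⟩ := h
  exact ⟨fun i => b i.rev, fun j => a j.rev, fun i j => (hab _ _).trans Fin.rev_le_rev⟩

/-! ### Definable sets -/

section Definable

variable {V W : Type*} {R : V → W → Prop} {m n : ℕ} {X Y : Finset V}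

lemma DeltaDefinable.mono (h : DeltaDefinable R m X) (hmn : m ≤ n) : DeltaDefinable R n X := by
  obtain ⟨φ, h1, h2⟩ := h
  exact ⟨φ, h1.trans hmn, h2⟩

lemma deltaDefinable_univ [Fintype V] : DeltaDefinable R 0 (univ : Finset V) :=
  ⟨.neg .falsum, le_rfl, fun x => by simp [DeltaFormula.Realize]⟩

lemma DeltaDefinable.sdiff [DecidableEq V] (hX : DeltaDefinable R m X)
    (hY : DeltaDefinable R n Y) : DeltaDefinable R (m + n) (X \ Y) := by
  obtain ⟨φ, h1, h2⟩ := hX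
  obtain ⟨ψ, h3, h4⟩ := hY
  exact ⟨.and φ (.neg ψ), add_le_add h1 h3, fun x => by simp [DeltaFormula.Realize, h2, h4]⟩

lemma DeltaDefinable.union [DecidableEq V] (hX : DeltaDefinable R m X)
    (hY : DeltaDefinable R n Y) : DeltaDefinable R (m + n) (X ∪ Y) := by
  obtain ⟨φ, h1, h2⟩ := hX
  obtain ⟨ψ, h3, h4⟩ := hY
  exact ⟨.neg (.and (.neg φ) (.neg ψ)), add_le_add h1 h3, fun x => by
    simp [DeltaFormula.Realize, h2, h4]; tauto⟩

open Classical in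
lemma DeltaDefinable.filter (hX : DeltaDefinable R m X) (b : W) :
    DeltaDefinable R (m + 1) {a ∈ X | R a b} := by
  obtain ⟨φ, h1, h2⟩ := hX
  exact ⟨.and φ (.edge b), add_le_add h1 le_rfl, fun x => by simp [DeltaFormula.Realize, h2]⟩

open Classical in
lemma DeltaDefinable.filter_not (hX : DeltaDefinable R m X) (b : W) :
    DeltaDefinable R (m + 1) {a ∈ X | ¬ R a b} := by
  obtain ⟨φ, h1, h2⟩ := hX
  exact ⟨.and φ (.neg (.edge b)), add_le_add h1 le_rfl, fun x => by
    simp [DeltaFormula.Realize, h2]⟩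

end Definable

/-! ### Partitions into good sets -/

open Classical in
/-- `A` is `η`-good: each `b` is joined to all but a proportion `η` of `A`, or to at most a
proportion `η` of `A`. -/
def Good {V W : Type*} (R : V → W → Prop) (η : ℝ) (A : Finset V) : Prop :=
  ∀ b : W, (#{a ∈ A | R a b} : ℝ) ≤ η * #A ∨ (#{a ∈ A | ¬ R a b} : ℝ) ≤ η * #A

section Good

variable {V W : Type*} {R : V → W → Prop}

/-- As long as a set is not good, some `b` splits it into two parts neither of which is small. A
bound on the height of shattered trees bounds the number of times this has to be repeated. -/
lemma exists_good_subset {η : ℝ} (hη0 : 0 < η) (hη1 : η ≤ 1) (d : ℕ) {n : ℕ} {X : Finset V}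
    (hd : ¬ Shatters R d (X : Set V) Set.univ) (hX : X.Nonempty) (hn : DeltaDefinable R n X) :
    ∃ A ⊆ X, A.Nonempty ∧ Good R η A ∧ DeltaDefinable R (n + d) A ∧ η ^ d * #X ≤ #A := by
  classical
  induction d generalizing X n with
  | zero => exact absurd (by simpa [Shatters] using hX) hd
  | succ d ih =>
    by_cases hg : Good R η X
    · exact ⟨X, subset_rfl, hX, hg, hn.mono (by omega),
        mul_le_of_le_one_left (by positivity) (pow_le_one₀ hη0.le hη1)⟩
    have hX0 : (0 : ℝ) < #X := by exact_mod_cast hX.card_pos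
    -- Recursion into a part `Y` of `X` of size at least `η * #X`.
    have key : ∀ Y ⊆ X, ¬ Shatters R d (Y : Set V) Set.univ → η * #X < #Y →
        DeltaDefinable R (n + 1) Y → ∃ A ⊆ X, A.Nonempty ∧ Good R η A ∧
          DeltaDefinable R (n + (d + 1)) A ∧ η ^ (d + 1) * #X ≤ #A := by
      intro Y hYX hYd hYc hYn
      have hY0 : 0 < #Y := by
        have : (0 : ℝ) < #Y := (mul_pos hη0 hX0).trans hYc
        exact_mod_cast this
      obtain ⟨A, h1, h2, h3, h4, h5⟩ := ih hYd (card_pos.1 hY0) hYn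
      refine ⟨A, h1.trans hYX, h2, h3, h4.mono (by omega), le_trans ?_ h5⟩
      rw [pow_succ, mul_assoc]
      gcongr
    simp only [Good, not_forall, not_or, not_le] at hg
    obtain ⟨b, hb1, hb2⟩ := hg
    by_cases h1 : Shatters R d (({a ∈ X | R a b} : Finset V) : Set V) Set.univ
    · by_cases h2 : Shatters R d (({a ∈ X | ¬ R a b} : Finset V) : Set V) Set.univ
      · exact absurd ⟨b, Set.mem_univ _, by simpa using h1, by simpa using h2⟩ hd
      · exact key _ (filter_subset _ _) h2 hb2 (hn.filter_not b)
    · exact key _ (filter_subset _ _) h1 hb1 (hn.filter b)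

/-- Removing good subsets `m` times leaves a remainder `Z` of exponentially small size. -/
lemma exists_finpartition_sdiff (η : ℝ) (hη0 : 0 < η) (hη1 : η ≤ 1) (d n m : ℕ) :
    ∃ N : ℕ, ∀ {V : Type u} {W : Type v} [DecidableEq V] (R : V → W → Prop) (X : Finset V),
      (∀ Y : Finset V, ¬ Shatters R d (Y : Set V) Set.univ) → DeltaDefinable R n X →
      ∃ Z ⊆ X, ∃ P : Finpartition (X \ Z), #P.parts ≤ m ∧
        (∀ A ∈ P.parts, Good R η A ∧ DeltaDefinable R N A) ∧ DeltaDefinable R N Z ∧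
        (#Z : ℝ) ≤ (1 - η ^ d) ^ m * #X := by
  induction m with
  | zero =>
    refine ⟨n, fun R X _ hX => ⟨X, subset_rfl, (Finpartition.empty _).copy (by simp), ?_⟩⟩
    simp [hX]
  | succ m ih =>
    obtain ⟨N, hN⟩ := ih
    refine ⟨N + (N + d), fun R X hd hX => ?_⟩
    obtain ⟨Z, hZX, P, hPm, hP, hZ, hZc⟩ := hN R X hd hX
    have hc1 : η ^ d ≤ 1 := pow_le_one₀ hη0.le hη1
    rcases Z.eq_empty_or_nonempty with rfl | hZ0
    · refine ⟨∅, hZX, P, by omega, fun A hA => ⟨(hP A hA).1, (hP A hA).2.mono (by omega)⟩,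
        hZ.mono (by omega), ?_⟩
      have := sub_nonneg.2 hc1
      simp only [card_empty, Nat.cast_zero]
      positivity
    obtain ⟨A, hAZ, hA0, hAg, hAN, hAc⟩ := exists_good_subset hη0 hη1 d (hd Z) hZ0 hZ
    refine ⟨Z \ A, sdiff_subset.trans hZX,
      P.extend (b := A) (c := X \ (Z \ A)) hA0.ne_empty
        (disjoint_of_subset_right hAZ sdiff_disjoint) ?_, ?_, ?_, hZ.sdiff hAN, ?_⟩
    · ext x
      have := @hAZ x
      have := @hZX x
      simp only [sup_eq_union, mem_union, mem_sdiff]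
      tauto
    · rw [Finpartition.card_extend]
      omega
    · intro B hB
      rcases mem_insert.1 hB with rfl | hB
      · exact ⟨hAg, hAN.mono (by omega)⟩
      · exact ⟨(hP B hB).1, (hP B hB).2.mono (by omega)⟩
    · rw [cast_card_sdiff hAZ, pow_succ]
      calc (#Z : ℝ) - #A ≤ (1 - η ^ d) * #Z := by linarith
        _ ≤ (1 - η ^ d) * ((1 - η ^ d) ^ m * #X) :=
          mul_le_mul_of_nonneg_left hZc (sub_nonneg.2 hc1)
        _ = _ := by ring

lemma Good.union [DecidableEq V] {η : ℝ} {A Z : Finset V} (hη0 : 0 ≤ η)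
    (hA : Good R η A) (hZ : (#Z : ℝ) ≤ η * #A) : Good R (2 * η) (A ∪ Z) := by
  classical
  intro b
  have hle : (#A : ℝ) ≤ #(A ∪ Z) := by exact_mod_cast card_le_card subset_union_left
  have key : ∀ (p : V → Prop) [DecidablePred p], (#{a ∈ A | p a} : ℝ) ≤ η * #A →
      (#{a ∈ A ∪ Z | p a} : ℝ) ≤ 2 * η * #(A ∪ Z) := by
    intro p _ hp
    have h1 : #{a ∈ A ∪ Z | p a} ≤ #{a ∈ A | p a} + #Z := by
      rw [filter_union]
      exact (card_union_le _ _).trans (Nat.add_le_add_left (card_filter_le _ _) _)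
    have h2 : (#{a ∈ A ∪ Z | p a} : ℝ) ≤ #{a ∈ A | p a} + #Z := by exact_mod_cast h1
    have h3 := mul_le_mul_of_nonneg_left hle hη0
    linarith
  exact (hA b).imp (key _) (key _)

lemma Good.mono {η η' : ℝ} {A : Finset V} (h : Good R η A) (hη : η ≤ η') : Good R η' A :=
  fun b => (h b).imp (fun h => h.trans (by gcongr)) fun h => h.trans (by gcongr)

/-- The partition of a stable graph into good sets. What remains after removing good subsets
sufficiently often is small compared to the first of them, and is added to it. -/
lemma exists_good_finpartition (k : ℕ) (η : ℝ) (hη0 : 0 < η) (hη1 : η ≤ 1) :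
    ∃ N : ℕ, ∀ (V : Type u) (W : Type v) [Fintype V] [DecidableEq V] (R : V → W → Prop),
      ¬ HasOrderProperty R k → ∃ P : Finpartition (univ : Finset V), #P.parts ≤ N ∧
        ∀ A ∈ P.parts, Good R η A ∧ DeltaDefinable R N A := by
  obtain ⟨d, hd⟩ := exists_not_shatters.{u, v} k
  have hη0' : 0 < η / 2 := by positivity
  have hη1' : η / 2 ≤ 1 := by linarith
  set c : ℝ := (η / 2) ^ d
  have hc0 : 0 < c := by positivity
  have hc1 : c ≤ 1 := pow_le_one₀ hη0'.le hη1'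
  obtain ⟨m, hm⟩ := exists_pow_lt_of_lt_one (mul_pos hη0' hc0) (sub_lt_self 1 hc0)
  obtain ⟨N, hN⟩ := exists_finpartition_sdiff.{u, v} (η / 2) hη0' hη1' d (0 + (0 + d)) m
  refine ⟨m + 1 + (0 + d + N), fun V W _ _ R hR => ?_⟩
  have hd' := fun Y : Finset V => hd R hR (Y : Set V) Set.univ
  rcases (univ : Finset V).eq_empty_or_nonempty with hV | hV
  · exact ⟨(Finpartition.empty _).copy hV.symm, by simp, by simp⟩
  obtain ⟨A, -, hA0, hAg, hAd, hAc⟩ :=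
    exists_good_subset hη0' hη1' d (hd' univ) hV deltaDefinable_univ
  obtain ⟨Z, hZX, P, hPm, hP, hZ, hZc⟩ := hN R (univ \ A) hd' (deltaDefinable_univ.sdiff hAd)
  have hZA : (#Z : ℝ) ≤ η / 2 * #A := by
    have hle : (#(univ \ A) : ℝ) ≤ #(univ : Finset V) := by
      exact_mod_cast card_le_card (subset_univ _)
    calc (#Z : ℝ) ≤ (1 - c) ^ m * #(univ \ A) := hZc
      _ ≤ η / 2 * c * #(univ : Finset V) := by gcongr
      _ = η / 2 * (c * #(univ : Finset V)) := by ring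
      _ ≤ η / 2 * #A := by gcongr
  refine ⟨P.extend (b := A ∪ Z) (c := univ) (hA0.mono subset_union_left).ne_empty ?_ ?_, ?_, ?_⟩
  · rw [disjoint_left]
    intro x hx
    simp only [mem_sdiff, mem_univ, true_and, mem_union] at hx ⊢
    tauto
  · ext x
    simp only [sup_eq_union, mem_union, mem_sdiff, mem_univ, true_and]
    tauto
  · rw [Finpartition.card_extend]
    omega
  · intro B hB
    rcases mem_insert.1 hB with rfl | hB
    · exact ⟨(hAg.union hη0'.le hZA).mono (by linarith), (hAd.union hZ).mono (by omega)⟩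
    · exact ⟨(hP B hB).1.mono (by linarith), (hP B hB).2.mono (by omega)⟩

end Good

/-! ### Densities -/

section Density

variable {V W : Type*} {R S : V → W → Prop} {A A' : Finset V} {B B' : Finset W}

lemma density_mul [DecidableRel S] (hA : A.Nonempty) (hB : B.Nonempty) :
    density S A B * (#A * #B) = #{x ∈ A ×ˢ B | S x.1 x.2} := by
  have h1 : (#A : ℝ) ≠ 0 := by exact_mod_cast hA.card_ne_zero
  have h2 : (#B : ℝ) ≠ 0 := by exact_mod_cast hB.card_ne_zero
  rw [density, Rel.edgeDensity]
  push_cast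
  rw [div_mul_cancel₀ _ (mul_ne_zero h1 h2), Rel.interedges]
  congr!

lemma density_mul_eq_sum [DecidableRel S] (hA : A.Nonempty) (hB : B.Nonempty) :
    density S A B * (#A * #B) = ∑ a ∈ A, (#{b ∈ B | S a b} : ℝ) := by
  rw [density_mul hA hB, card_filter, sum_product]
  push_cast [card_filter]
  rfl

lemma density_flip : density (flip S) B A = density S A B := by
  classical
  have : #(Rel.interedges (flip S) B A) = #(Rel.interedges S A B) :=
    card_equiv (Equiv.prodComm _ _) fun x => by
      simp only [Rel.mem_interedges_iff, flip, Equiv.prodComm_apply, Prod.fst_swap, Prod.snd_swap]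
      tauto
  unfold density Rel.edgeDensity
  rw [mul_comm (#B : ℚ)]
  congr!

lemma density_nonneg : 0 ≤ density S A B := by
  classical
  exact Rat.cast_nonneg.2 (Rel.edgeDensity_nonneg _ _ _)

lemma density_add_density_not (hA : A.Nonempty) (hB : B.Nonempty) :
    density R A B + density (fun a b => ¬ R a b) A B = 1 := by
  classical
  unfold density
  have := Rel.edgeDensity_add_edgeDensity_compl R hA hB
  rw [← Rat.cast_add]
  norm_cast
  convert this

lemma sum_le_of_card_le {U : Type*} {X Y : Finset U} {f : U → ℝ} {s M : ℝ} (hs : 0 ≤ s)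
    (hM : 0 ≤ M) (hYX : Y ⊆ X) (hY : (#Y : ℝ) ≤ s * #X) (hf : ∀ x ∈ X, f x ≤ M)
    (hf' : ∀ x ∈ X, x ∉ Y → f x ≤ s * M) : ∑ x ∈ X, f x ≤ 2 * s * (#X * M) := by
  classical
  have h1 : ∑ x ∈ X \ Y, f x ≤ #(X \ Y) * (s * M) := by
    rw [← nsmul_eq_mul]
    exact sum_le_card_nsmul _ _ _ fun x hx => hf' x (mem_sdiff.1 hx).1 (mem_sdiff.1 hx).2
  have h2 : ∑ x ∈ Y, f x ≤ #Y * M := by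
    rw [← nsmul_eq_mul]
    exact sum_le_card_nsmul _ _ _ fun x hx => hf x (hYX hx)
  have h3 : (#(X \ Y) : ℝ) ≤ #X := by exact_mod_cast card_le_card sdiff_subset
  have h4 := mul_le_mul_of_nonneg_right h3 (mul_nonneg hs hM)
  have h5 := mul_le_mul_of_nonneg_right hY hM
  rw [← sum_sdiff hYX]
  linarith

/-- If each side is good for the other then the pair is nearly complete or nearly empty. Let `A₁` be
the set of `a ∈ A` joined to most of `B` and `B₀` the set of `b ∈ B` joined to few elements of `A`.
Counting the edges between `A₁` and `B₀` in two ways shows that one of these sets is small. -/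
lemma Good.density_le {η s : ℝ} (hs : 0 ≤ s) (hη : 2 * η ≤ s ^ 2) (hηs : η ≤ s)
    (hA : A.Nonempty) (hB : B.Nonempty) (hgA : Good R η A) (hgB : Good (_root_.flip R) η B) :
    density R A B ≤ 2 * s ∨ density (fun a b => ¬ R a b) A B ≤ 2 * s := by
  classical
  have hA0 : (0 : ℝ) < #A := by exact_mod_cast hA.card_pos
  have hB0 : (0 : ℝ) < #B := by exact_mod_cast hB.card_pos
  set A₁ : Finset V := {a ∈ A | (#{b ∈ B | ¬ R a b} : ℝ) ≤ η * #B}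
  set B₀ : Finset W := {b ∈ B | (#{a ∈ A | R a b} : ℝ) ≤ η * #A}
  have hη0 : 0 ≤ η := by
    obtain ⟨a, -⟩ := hA
    rcases hgB a with h | h
    · exact nonneg_of_mul_nonneg_left ((Nat.cast_nonneg _).trans h) hB0
    · exact nonneg_of_mul_nonneg_left ((Nat.cast_nonneg _).trans h) hB0
  have hA₁A : (#A₁ : ℝ) ≤ #A := by exact_mod_cast card_le_card (filter_subset _ _)
  have hB₀B : (#B₀ : ℝ) ≤ #B := by exact_mod_cast card_le_card (filter_subset _ _)
  have hcount : (#A₁ : ℝ) * #B₀ ≤ 2 * η * (#A * #B) := by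
    have e1 : ∑ a ∈ A₁, (#{b ∈ B₀ | R a b} : ℝ) = ∑ b ∈ B₀, (#{a ∈ A₁ | R a b} : ℝ) := by
      exact_mod_cast sum_card_bipartiteAbove_eq_sum_card_bipartiteBelow R
    have e2 : ∑ b ∈ B₀, (#{a ∈ A₁ | R a b} : ℝ) ≤ #B₀ * (η * #A) := by
      rw [← nsmul_eq_mul]
      refine sum_le_card_nsmul _ _ _ fun b hb => le_trans ?_ (mem_filter.1 hb).2
      exact_mod_cast card_le_card (filter_subset_filter _ (filter_subset _ _))
    have e3 : #A₁ * (#B₀ - η * #B) ≤ ∑ a ∈ A₁, (#{b ∈ B₀ | R a b} : ℝ) := by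
      rw [← nsmul_eq_mul]
      refine card_nsmul_le_sum _ _ _ fun a ha => ?_
      have h1 := (mem_filter.1 ha).2
      have h2 : (#{b ∈ B₀ | ¬ R a b} : ℝ) ≤ #{b ∈ B | ¬ R a b} := by
        exact_mod_cast card_le_card (filter_subset_filter _ (filter_subset _ _))
      have h3 : (#{b ∈ B₀ | R a b} : ℝ) + #{b ∈ B₀ | ¬ R a b} = #B₀ := by
        exact_mod_cast card_filter_add_card_filter_not _
      linarith
    nlinarith [mul_le_mul_of_nonneg_right hA₁A (mul_nonneg hη0 hB0.le),
      mul_le_mul_of_nonneg_right hB₀B (mul_nonneg hη0 hA0.le)]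
  have hfin : 0 < (#A : ℝ) * #B := mul_pos hA0 hB0
  by_cases hcase : (#A₁ : ℝ) ≤ s * #A
  · left
    refine le_of_mul_le_mul_right ?_ hfin
    rw [density_mul_eq_sum hA hB]
    refine sum_le_of_card_le hs hB0.le (filter_subset _ A) hcase
      (fun a _ => by exact_mod_cast card_filter_le _ _) fun a ha haA => ?_
    have h1 := (hgB a).resolve_right fun h => haA (mem_filter.2 ⟨ha, h⟩)
    exact h1.trans (by gcongr)
  · right
    have hB₀s : (#B₀ : ℝ) ≤ s * #B := by
      by_contra hlt
      have := mul_lt_mul'' (not_le.1 hcase) (not_le.1 hlt) (by positivity) (by positivity)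
      nlinarith [mul_le_mul_of_nonneg_right hη hfin.le]
    refine le_of_mul_le_mul_right ?_ (mul_comm (#A : ℝ) #B ▸ hfin)
    rw [← density_flip, density_mul_eq_sum hB hA]
    refine sum_le_of_card_le hs hA0.le (filter_subset _ B) hB₀s
      (fun b _ => by exact_mod_cast card_filter_le _ _) fun b hb hbB => ?_
    have h1 := (hgA b).resolve_left fun h => hbB (mem_filter.2 ⟨hb, h⟩)
    refine (le_of_eq ?_).trans (h1.trans (mul_le_mul_of_nonneg_right hηs hA0.le))
    unfold _root_.flip
    congr!

/-- Markov's inequality: few exceptional pairs in total, so few exceptional `a`. -/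
lemma mostlyHolds_of_density_not_le {ε : ℝ} (hε : 0 < ε) (hA : A.Nonempty) (hB : B.Nonempty)
    (h : density (fun a b => ¬ S a b) A B ≤ ε ^ 2) : MostlyHolds S ε A B := by
  classical
  have hA0 : (0 : ℝ) < #A := by exact_mod_cast hA.card_pos
  have hB0 : (0 : ℝ) < #B := by exact_mod_cast hB.card_pos
  refine ⟨{a ∈ A | ε * #B < #{b ∈ B | ¬ S a b}}, filter_subset _ _, ?_, fun a ha haE =>
    ⟨{b ∈ B | ¬ S a b}, filter_subset _ _, ?_, fun b hb hbF => ?_⟩⟩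
  · set E := {a ∈ A | ε * #B < #{b ∈ B | ¬ S a b}}
    have h1 : #E * (ε * #B) ≤ ∑ a ∈ A, (#{b ∈ B | ¬ S a b} : ℝ) := by
      rw [← nsmul_eq_mul]
      refine (card_nsmul_le_sum E _ _ fun a ha => (mem_filter.1 ha).2.le).trans ?_
      exact sum_le_sum_of_subset_of_nonneg (filter_subset _ _) fun _ _ _ => by positivity
    rw [← density_mul_eq_sum (S := fun a b => ¬ S a b) hA hB] at h1
    have h2 : (#E : ℝ) * (ε * #B) ≤ ε * #A * (ε * #B) :=
      h1.trans ((mul_le_mul_of_nonneg_right h (by positivity)).trans_eq (by ring))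
    exact le_of_mul_le_mul_right h2 (by positivity)
  · by_contra hlt
    exact haE (mem_filter.2 ⟨ha, not_le.1 hlt⟩)
  · by_contra hS
    exact hbF (mem_filter.2 ⟨hb, hS⟩)

lemma mostlyHoldsBoth_of_density_not_le {ε : ℝ} (hε : 0 < ε) (hA : A.Nonempty) (hB : B.Nonempty)
    (h : density (fun a b => ¬ S a b) A B ≤ ε ^ 2) : MostlyHoldsBoth S ε A B :=
  ⟨mostlyHolds_of_density_not_le hε hA hB h, mostlyHolds_of_density_not_le hε hB hA <|
    (density_flip (S := fun a b => ¬ S a b)).trans_le h⟩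

lemma density_le_of_subset {ε β : ℝ} (hε : 0 < ε) (hA : A.Nonempty) (hB : B.Nonempty)
    (hA' : A' ⊆ A) (hB' : B' ⊆ B) (hAc : ε * #A ≤ #A') (hBc : ε * #B ≤ #B')
    (h : density S A B ≤ β) : density S A' B' ≤ β / ε ^ 2 := by
  classical
  have hA0 : (0 : ℝ) < #A := by exact_mod_cast hA.card_pos
  have hB0 : (0 : ℝ) < #B := by exact_mod_cast hB.card_pos
  have hA0' : (0 : ℝ) < #A' := (mul_pos hε hA0).trans_le hAc
  have hB0' : (0 : ℝ) < #B' := (mul_pos hε hB0).trans_le hBc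
  have hAn : A'.Nonempty := card_pos.1 (by exact_mod_cast hA0')
  have hBn : B'.Nonempty := card_pos.1 (by exact_mod_cast hB0')
  have h0 : 0 ≤ β := density_nonneg.trans h
  have h1 : density S A' B' * (#A' * #B') ≤ density S A B * (#A * #B) := by
    rw [density_mul hA hB, density_mul hAn hBn]
    exact_mod_cast card_le_card (filter_subset_filter _ (product_subset_product hA' hB'))
  have h2 : ε ^ 2 * (#A * #B : ℝ) ≤ #A' * #B' :=
    calc ε ^ 2 * (#A * #B : ℝ) = ε * #A * (ε * #B) := by ring
      _ ≤ #A' * #B' := by gcongr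
  have h3 : density S A' B' * (#A' * #B') ≤ β / ε ^ 2 * (#A' * #B') :=
    calc density S A' B' * (#A' * #B') ≤ β * (#A * #B) := h1.trans (by gcongr)
      _ = β / ε ^ 2 * (ε ^ 2 * (#A * #B)) := by field_simp
      _ ≤ β / ε ^ 2 * (#A' * #B') := by gcongr
  exact le_of_mul_le_mul_right h3 (by positivity)

lemma nonempty_of_mul_card_le {ε : ℝ} {U : Type*} {X Y : Finset U} (hε : 0 < ε) (hX : X.Nonempty)
    (h : ε * #X ≤ #Y) : Y.Nonempty := by
  have hX0 : (0 : ℝ) < #X := by exact_mod_cast hX.card_pos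
  exact card_pos.1 (by exact_mod_cast (mul_pos hε hX0).trans_le h)

lemma nearlyComplete_of_density_not_le {ε β : ℝ} (hε : 0 < ε) (h2 : β ≤ ε ^ 2) (h4 : β ≤ ε ^ 4)
    (hA : A.Nonempty) (hB : B.Nonempty) (h : density (fun a b => ¬ S a b) A B ≤ β) :
    NearlyComplete S ε A B := by
  refine ⟨mostlyHoldsBoth_of_density_not_le hε hA hB (h.trans h2),
    fun A' hA' B' hB' hAc hBc => mostlyHoldsBoth_of_density_not_le hε
      (nonempty_of_mul_card_le hε hA hAc) (nonempty_of_mul_card_le hε hB hBc) ?_⟩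
  refine (density_le_of_subset hε hA hB hA' hB' hAc hBc h).trans ?_
  rw [div_le_iff₀ (by positivity)]
  linarith

lemma regularPair_of_density_le {ε β : ℝ} (hε : 0 < ε) (h1 : β < ε) (h3 : β < ε ^ 3)
    (hA : A.Nonempty) (hB : B.Nonempty) (h : density S A B ≤ β) : RegularPair S ε A B := by
  intro A' hA' B' hB' hAc hBc
  have := density_le_of_subset hε hA hB hA' hB' hAc hBc h
  have hlt : β / ε ^ 2 < ε := by
    rw [div_lt_iff₀ (by positivity)]
    linarith
  rw [abs_sub_lt_iff]
  constructor <;> linarith [density_nonneg (S := S) (A := A) (B := B),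
    density_nonneg (S := S) (A := A') (B := B')]

lemma RegularPair.of_not {ε : ℝ} (hε : 0 < ε) (hA : A.Nonempty) (hB : B.Nonempty)
    (h : RegularPair (fun a b => ¬ R a b) ε A B) : RegularPair R ε A B := by
  intro A' hA' B' hB' hAc hBc
  have h1 : |density (fun a b => ¬ R a b) A' B' - density (fun a b => ¬ R a b) A B| < ε :=
    h A' hA' B' hB' hAc hBc
  have h2 := density_add_density_not (R := R) hA hB
  have h3 := density_add_density_not (R := R) (nonempty_of_mul_card_le hε hA hAc)
    (nonempty_of_mul_card_le hε hB hBc)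
  show |density R A' B' - density R A B| < ε
  rw [abs_sub_lt_iff] at h1 ⊢
  constructor <;> linarith [h1.1, h1.2]

lemma exists_mem_notMem_notMem {ε : ℝ} {U : Type*} {X E F : Finset U} (hε : ε < 1 / 2)
    (hX : X.Nonempty) (hE : (#E : ℝ) ≤ ε * #X) (hF : (#F : ℝ) ≤ ε * #X) :
    ∃ x ∈ X, x ∉ E ∧ x ∉ F := by
  classical
  by_contra! hne
  have hX0 : (0 : ℝ) < #X := by exact_mod_cast hX.card_pos
  have h1 : (#X : ℝ) ≤ #E + #F := by
    exact_mod_cast (card_le_card fun x hx => mem_union.2 <|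
      or_iff_not_imp_left.2 (hne x hx)).trans (card_union_le E F)
  nlinarith

lemma MostlyHolds.not_mostlyHolds_not {ε : ℝ} (hε : ε < 1 / 2) (hA : A.Nonempty)
    (hB : B.Nonempty) (h : MostlyHolds R ε A B) : ¬ MostlyHolds (fun a b => ¬ R a b) ε A B := by
  rintro ⟨E', -, hE', h'⟩
  obtain ⟨E, -, hE, h⟩ := h
  obtain ⟨a, ha, haE, haE'⟩ := exists_mem_notMem_notMem hε hA hE hE'
  obtain ⟨F, -, hF, h⟩ := h a ha haE
  obtain ⟨F', -, hF', h'⟩ := h' a ha haE'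
  obtain ⟨b, hb, hbF, hbF'⟩ := exists_mem_notMem_notMem hε hB hF hF'
  exact h' b hb hbF' (h b hb hbF)

lemma stableRegularPair_of_density_le {ε β : ℝ} (hε : 0 < ε) (h1 : β < ε) (h2 : β ≤ ε ^ 2)
    (h3 : β < ε ^ 3) (h4 : β ≤ ε ^ 4) (hA : A.Nonempty) (hB : B.Nonempty)
    (h : density R A B ≤ β ∨ density (fun a b => ¬ R a b) A B ≤ β) :
    StableRegularPair R ε A B := by
  refine ⟨?_, fun hε2 hb => hb.1.1.not_mostlyHolds_not hε2 hA hB hb.2.1, ?_⟩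
  · rcases h with h | h
    · refine Or.inr ⟨nearlyComplete_of_density_not_le hε h2 h4 hA hB ?_, h.trans_lt h1⟩
      simpa only [not_not] using h
    · refine Or.inl ⟨nearlyComplete_of_density_not_le hε h2 h4 hA hB h, ?_⟩
      linarith [density_add_density_not (R := R) hA hB]
  · rcases h with h | h
    · exact regularPair_of_density_le hε h1 h3 hA hB h
    · exact (regularPair_of_density_le hε h1 h3 hA hB h).of_not hε hA hB

end Density

/-- For a suitable `η`, goodness of both sides of a pair is all that the theorem asks for. -/
lemma exists_good_imp_stableRegularPair (ε : ℝ) (hε : 0 < ε) : ∃ η : ℝ, 0 < η ∧ η ≤ 1 ∧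
    ∀ {V : Type u} {W : Type v} (R : V → W → Prop) (A : Finset V) (B : Finset W),
      A.Nonempty → B.Nonempty → Good R η A → Good (flip R) η B → StableRegularPair R ε A B := by
  -- `min ε 1` because `ε` may exceed `1`, where the powers of `ε` increase.
  set e : ℝ := min ε 1
  have he0 : 0 < e := lt_min hε one_pos
  have he1 : e ≤ 1 := min_le_right _ _
  have heε : e ≤ ε := min_le_left _ _
  have hs0 : 0 < e ^ 4 / 4 := by positivity
  have hs1 : e ^ 4 ≤ 1 := pow_le_one₀ he0.le he1
  have hβ : ∀ j ≤ 4, 2 * (e ^ 4 / 4) < ε ^ j := fun j hj =>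
    calc 2 * (e ^ 4 / 4) < e ^ 4 := by linarith
      _ ≤ e ^ j := pow_le_pow_of_le_one he0.le he1 hj
      _ ≤ ε ^ j := by gcongr
  -- With `s = e ^ 4 / 4` and `η = s ^ 2 / 2`, a good pair has density at most `2 * s` for `R` or `¬ R`.
  refine ⟨(e ^ 4 / 4) ^ 2 / 2, by positivity, by nlinarith, fun R A B hA hB hgA hgB => ?_⟩
  exact stableRegularPair_of_density_le hε (by simpa using hβ 1 (by norm_num))
    (hβ 2 (by norm_num)).le (hβ 3 (by norm_num)) (hβ 4 le_rfl).le hA hB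
    (hgA.density_le hs0.le (by linarith) (by nlinarith) hA hB hgB)

end StableGraph

theorem mainTheorem2 (k : ℕ) (ε : ℝ) (hε : 0 < ε) :
    ∃ N : ℕ,
      (∀ (V : Type u) (W : Type v) [Fintype V] [Fintype W] [DecidableEq V] [DecidableEq W]
        (R : V → W → Prop), ¬ StableGraph.HasOrderProperty R k →
        ∃ (P : Finpartition (Finset.univ : Finset V)) (Q : Finpartition (Finset.univ : Finset W)),
          P.parts.card ≤ N ∧ Q.parts.card ≤ N ∧
          (∀ A ∈ P.parts, StableGraph.DeltaDefinable R N A) ∧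
          (∀ B ∈ Q.parts, StableGraph.DeltaDefinable (flip R) N B) ∧
          ∀ A ∈ P.parts, ∀ B ∈ Q.parts, StableGraph.StableRegularPair R ε A B) ∧
      (∀ (V : Type u) [Fintype V] [DecidableEq V] (G : SimpleGraph V),
        ¬ StableGraph.HasOrderProperty G.Adj k →
        ∃ P : Finpartition (Finset.univ : Finset V),
          P.parts.card ≤ N ∧
          (∀ A ∈ P.parts, StableGraph.DeltaDefinable G.Adj N A) ∧
          ∀ A ∈ P.parts, ∀ B ∈ P.parts, StableGraph.StableRegularPair G.Adj ε A B) := by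
  -- The constants are obtained once for each pair of universes in which they are needed.
  obtain ⟨η₁, hη0₁, hη1₁, hη₁⟩ := StableGraph.exists_good_imp_stableRegularPair.{u, v} ε hε
  obtain ⟨η₂, hη0₂, hη1₂, hη₂⟩ := StableGraph.exists_good_imp_stableRegularPair.{u, u} ε hε
  obtain ⟨N₁, hN₁⟩ := StableGraph.exists_good_finpartition.{u, v} k η₁ hη0₁ hη1₁
  obtain ⟨N₂, hN₂⟩ := StableGraph.exists_good_finpartition.{v, u} k η₁ hη0₁ hη1₁
  obtain ⟨N₃, hN₃⟩ := StableGraph.exists_good_finpartition.{u, u} k η₂ hη0₂ hη1₂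
  refine ⟨N₁ + N₂ + N₃, fun V W _ _ _ _ R hR => ?_, fun V _ _ G hG => ?_⟩
  · obtain ⟨P, hPc, hP⟩ := hN₁ V W R hR
    obtain ⟨Q, hQc, hQ⟩ := hN₂ W V (flip R) fun h => hR h.flip
    exact ⟨P, Q, by omega, by omega, fun A hA => (hP A hA).2.mono (by omega),
      fun B hB => (hQ B hB).2.mono (by omega), fun A hA B hB => hη₁ R A B
        (P.nonempty_of_mem_parts hA) (Q.nonempty_of_mem_parts hB) (hP A hA).1 (hQ B hB).1⟩
  · obtain ⟨P, hPc, hP⟩ := hN₃ V V G.Adj hG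
    have hflip : flip G.Adj = G.Adj := by
      ext a b
      exact G.adj_comm b a
    exact ⟨P, by omega, fun A hA => (hP A hA).2.mono (by omega), fun A hA B hB => hη₂ G.Adj A B
      (P.nonempty_of_mem_parts hA) (P.nonempty_of_mem_parts hB) (hP A hA).1
      (hflip.symm ▸ (hP B hB).1)⟩
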